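/- There exist absolute constants $c_1,c_2>0$ such that the following holds. Let $A\in\mathbb{R}^{m\times n}$ have singular value decomposition $A=U\Sigma V^T$ with $\rho=\operatorname{rank}(A)$ terms and singular values in nonincreasing order, let $1\le k\le\rho$, let $U_k,V_k$ consist of the first $k$ columns of $U,V$, and let $A_k=U_k\Sigma_kV_k^T$ be the corresponding best rank-$k$ approximation of $A$. Suppose that the column space incoherence $\mu=\frac{m}{k}\max_i\|U_k^Te_i\|_2^2$ satisfies $\mu\le\mu_0$. Let $\varepsilon\in(0,1)$, and let the columns of $A$ be partitioned into $G$ predefined blocks of at most $s$ columns each (for instance, $G=\lceil n/s\rceil$ blocks of $s$ consecutive columns). For a block $i$ let $E_i\in\mathbb{R}^{n\times s}$ consist of the columns of the identity matrix that belong to block $i$ (padded with zero columns if there are fewer than $s$). Consider the following algorithm. 1. Draw $r$ row indices independently and uniformly from $\{1,\dots,m\}$, and let $R\in\mathbb{R}^{r\times n}$ consist of the corresponding rows of $A$, each multiplied by $\sqrt{m/r}$. 2. Let $V_R\in\mathbb{R}^{n\times q}$ consist of the top right singular vectors of $R$: $R=U_R\Sigma_RV_R^T$ is a singular value decomposition with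 $q\ge1$ terms, where $U_R,V_R$ have orthonormal columns and zero singular values are allowed, so that $\operatorname{rank}(R)\le q\le\min\{r,n\}$ (and $q=r$ if $R$ has rank $r$). Any such choice is admissible. Draw $g$ blocks $j_1,\dots,j_g\in\{1,\dots,G\}$ independently with probabilities $p_i=\|V_R^TE_i\|_F^2/q$. Let $S\in\mathbb{R}^{n\times gs}$ be the matrix whose $t$-th block of $s$ columns is $E_{j_t}/\sqrt{g\,p_{j_t}}$, and let $C=AS$. 3. Let $W=RS$ and $U_W=W^\dagger$ (the Moore–Penrose pseudoinverse), and output $CU_WR$. Let $\alpha_R=\min_i\|V_R^TE_i\|_F^2/\|V_R^TE_i\|_2^2$ be the block stable rank, the minimum being over the blocks with $V_R^TE_i\ne0$. If $$r\ \ge\ c_1\,\frac{\mu_0k^2}{\varepsilon^2}\qquad\text{and}\qquad g\ \ge\ c_2\,\frac{r^2}{\alpha_R\,\varepsilon^2},$$ where $g$ may depend on the sampled rows (as $\alpha_R$ does), then with probability at least $0.7$ $$\|A-CU_WR\|_F\ \le\ (1+\varepsilon)\,\|A-A_k\|_F .$$ -/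

import Mathlib

noncomputable section

namespace BlockCUR

open scoped Matrix
open Matrix

/-- The Frobenius norm of a real matrix. -/
def frobNorm {α β : Type*} [Fintype α] [Fintype β] (M : Matrix α β ℝ) : ℝ :=
  Real.sqrt (∑ i, ∑ j, M i j ^ 2)

open scoped Matrix.Norms.L2Operator in
/-- The spectral norm of a real matrix: the operator norm between Euclidean spaces. -/
def specNorm {α β : Type*} [Fintype α] [Fintype β] [DecidableEq β] (M : Matrix α β ℝ) : ℝ :=
  ‖M‖

/-- `A = U Σ Vᵀ` is a singular value decomposition with `q` terms: `U` and `V` have orthonormal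
columns and `Σ = diag (σ 0, …, σ (q-1))` with `σ 0 ≥ σ 1 ≥ … ≥ 0`. -/
structure IsSVD {m n q : ℕ} (A : Matrix (Fin m) (Fin n) ℝ) (U : Matrix (Fin m) (Fin q) ℝ)
    (σ : Fin q → ℝ) (V : Matrix (Fin n) (Fin q) ℝ) : Prop where
  orthonormal_left : Uᵀ * U = 1
  orthonormal_right : Vᵀ * V = 1
  antitone : Antitone σ
  nonneg : ∀ t, 0 ≤ σ t
  eq : A = U * diagonal σ * Vᵀ

/-- The first `k` columns of a matrix. -/
def firstCols {m q k : ℕ} (hk : k ≤ q) (U : Matrix (Fin m) (Fin q) ℝ) : Matrix (Fin m) (Fin k) ℝ :=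
  U.submatrix id (Fin.castLE hk)

/-- The best rank-`k` approximation `A_k = U_k Σ_k V_kᵀ` read off from an SVD. -/
def svdTrunc {m n q k : ℕ} (hk : k ≤ q) (U : Matrix (Fin m) (Fin q) ℝ) (σ : Fin q → ℝ)
    (V : Matrix (Fin n) (Fin q) ℝ) : Matrix (Fin m) (Fin n) ℝ :=
  firstCols hk U * diagonal (fun t => σ (Fin.castLE hk t)) * (firstCols hk V)ᵀ

/-- The column space incoherence `(m / k) max_i ‖U_kᵀ e_i‖₂²` of an `m × k` matrix `U_k`. -/
def incoherence {m k : ℕ} (Uk : Matrix (Fin m) (Fin k) ℝ) : ℝ :=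
  (m : ℝ) / (k : ℝ) * ⨆ i : Fin m, ∑ t, Uk i t ^ 2

/-- The Moore–Penrose pseudoinverse `W† = (WᵀW)† Wᵀ`. The pseudoinverse of `WᵀW = Q Λ Qᵀ` is
`Q Λ⁻¹ Qᵀ`, where the nonzero eigenvalues are inverted and the zero ones are kept (`0⁻¹ = 0`). -/
def pinv {α β : Type*} [Fintype α] [Fintype β] [DecidableEq β] (W : Matrix α β ℝ) :
    Matrix β α ℝ :=
  let h : (Wᴴ * W).IsHermitian := isHermitian_conjTranspose_mul_self W
  (h.eigenvectorUnitary : Matrix β β ℝ) * diagonal (fun b => (h.eigenvalues b)⁻¹) *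
    (h.eigenvectorUnitary : Matrix β β ℝ)ᵀ * Wᵀ

/-- `pinv W` satisfies the four Penrose equations, which characterize the pseudoinverse. -/
theorem pinv_penrose {α β : Type*} [Fintype α] [Fintype β] [DecidableEq β] (W : Matrix α β ℝ) :
    W * pinv W * W = W ∧ pinv W * W * pinv W = pinv W ∧
      (W * pinv W)ᵀ = W * pinv W ∧ (pinv W * W)ᵀ = pinv W * W := by
  have h : (Wᴴ * W).IsHermitian := isHermitian_conjTranspose_mul_self W
  set Q : Matrix β β ℝ := (h.eigenvectorUnitary : Matrix β β ℝ) with hQ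
  have hQQ : Qᵀ * Q = 1 := by
    have := Unitary.coe_star_mul_self h.eigenvectorUnitary
    rwa [star_eq_conjTranspose, conjTranspose_eq_transpose_of_trivial] at this
  have hQQ' : Q * Qᵀ = 1 := by
    have := mul_eq_one_comm.mp hQQ
    exact this
  have hM : Wᵀ * W = Q * diagonal h.eigenvalues * Qᵀ := by
    have := h.spectral_theorem
    rw [Unitary.conjStarAlgAut_apply, star_eq_conjTranspose] at this
    exact this
  have hp : pinv W = Q * diagonal (fun b => (h.eigenvalues b)⁻¹) * Qᵀ * Wᵀ := rfl
  set l := h.eigenvalues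
  set G := Q * diagonal (fun b => (l b)⁻¹) * Qᵀ with hG
  have hGM : G * (Wᵀ * W) = Q * diagonal (fun b => (l b)⁻¹ * l b) * Qᵀ := by
    rw [hM, hG, ← diagonal_mul_diagonal]
    simp only [Matrix.mul_assoc]
    rw [← Matrix.mul_assoc Qᵀ Q, hQQ, Matrix.one_mul]
  have hGT : Gᵀ = G := by simp [hG, transpose_mul, Matrix.mul_assoc]
  have hGMT : (G * (Wᵀ * W))ᵀ = G * (Wᵀ * W) := by
    rw [hGM]; simp [transpose_mul, Matrix.mul_assoc]
  have hGMG : G * (Wᵀ * W) * G = G := by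
    rw [hGM, hG]
    simp only [Matrix.mul_assoc]
    rw [← Matrix.mul_assoc Qᵀ Q, hQQ, Matrix.one_mul, ← Matrix.mul_assoc (diagonal _) (diagonal _),
      diagonal_mul_diagonal]
    congr 3
    ext b
    by_cases hb : l b = 0 <;> simp [hb]
  have hMGM : Wᵀ * W * (G * (Wᵀ * W)) = Wᵀ * W := by
    rw [hGM, hM]
    simp only [Matrix.mul_assoc]
    rw [← Matrix.mul_assoc Qᵀ Q, hQQ, Matrix.one_mul, ← Matrix.mul_assoc (diagonal _) (diagonal _),
      diagonal_mul_diagonal]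
    congr 3
    ext b
    by_cases hb : l b = 0 <;> simp [hb]
  have hW : W * (G * (Wᵀ * W)) = W := by
    have key : (W * (G * (Wᵀ * W)) - W)ᴴ * (W * (G * (Wᵀ * W)) - W) = 0 := by
      rw [conjTranspose_eq_transpose_of_trivial, transpose_sub, transpose_mul, hGMT,
        Matrix.sub_mul, Matrix.mul_sub, Matrix.mul_sub]
      have e1 : G * (Wᵀ * W) * Wᵀ * (W * (G * (Wᵀ * W))) = G * (Wᵀ * W) * Wᵀ * W := by
        rw [Matrix.mul_assoc, ← Matrix.mul_assoc Wᵀ W, hMGM, ← Matrix.mul_assoc]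
      have e2 : Wᵀ * (W * (G * (Wᵀ * W))) = Wᵀ * W := by rw [← Matrix.mul_assoc, hMGM]
      rw [e1, e2]; simp
    exact sub_eq_zero.mp (conjTranspose_mul_self_eq_zero.mp key)
  rw [hp]
  refine ⟨?_, ?_, ?_, ?_⟩
  · calc W * (G * Wᵀ) * W = W * (G * (Wᵀ * W)) := by simp only [Matrix.mul_assoc]
      _ = W := hW
  · calc G * Wᵀ * W * (G * Wᵀ) = G * (Wᵀ * W) * G * Wᵀ := by simp only [Matrix.mul_assoc]
      _ = G * Wᵀ := by rw [hGMG]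
  · simp [transpose_mul, hGT, Matrix.mul_assoc]
  · rw [Matrix.mul_assoc, hGMT]

/-- The row sampling matrix `S_R` for the sampled row indices `I`, with uniform sampling
probabilities `1 / m`: column `t` is `e_{I t} / √(r · (1 / m))`. -/
def rowSamplingMatrix {m r : ℕ} (I : Fin r → Fin m) : Matrix (Fin m) (Fin r) ℝ :=
  fun i t => if i = I t then 1 / Real.sqrt ((r : ℝ) * (1 / (m : ℝ))) else 0

/-- The matrix `R = S_Rᵀ A` of sampled and scaled rows. -/
def rowSample {m n r : ℕ} (A : Matrix (Fin m) (Fin n) ℝ) (I : Fin r → Fin m) :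
    Matrix (Fin r) (Fin n) ℝ :=
  (rowSamplingMatrix I)ᵀ * A

/-- A choice of top right singular vectors of `R`: the right factor `V` of an SVD of `R` with at
least one term. The number `q` of terms is automatically at least the rank of `R` and at most
its numbers of rows and columns; `q = r` when `R` has full row rank `r`. -/
structure TopRightSingular {r n : ℕ} (R : Matrix (Fin r) (Fin n) ℝ) where
  /-- the number of singular vectors -/
  q : ℕ
  q_pos : 0 < q
  /-- the right singular vectors, as columns -/
  V : Matrix (Fin n) (Fin q) ℝ
  isSVD : ∃ (U : Matrix (Fin r) (Fin q) ℝ) (σ : Fin q → ℝ), IsSVD R U σ V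

/-- The `n × s` matrix `E_i` made of the columns of the identity matrix that belong to block `i`,
when column `l` is placed at position `blk l = (block, position inside the block)`. Positions that
are not used (blocks with fewer than `s` columns) are filled with zero columns. -/
def blockId {n G s : ℕ} (blk : Fin n ↪ Fin G × Fin s) (i : Fin G) : Matrix (Fin n) (Fin s) ℝ :=
  fun l a => if blk l = (i, a) then 1 else 0

/-- The block leverage score `‖Vᵀ E_i‖_F²`. -/
def blockLeverage {n q G s : ℕ} (blk : Fin n ↪ Fin G × Fin s) (V : Matrix (Fin n) (Fin q) ℝ)
    (i : Fin G) : ℝ :=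
  frobNorm (Vᵀ * blockId blk i) ^ 2

/-- The block sampling probability `p_i = ‖Vᵀ E_i‖_F² / q`. -/
def blockProb {n q G s : ℕ} (blk : Fin n ↪ Fin G × Fin s) (V : Matrix (Fin n) (Fin q) ℝ)
    (i : Fin G) : ℝ :=
  blockLeverage blk V i / (q : ℝ)

/-- The block sampling probabilities add up to one. -/
theorem sum_blockProb {n q G s : ℕ} (blk : Fin n ↪ Fin G × Fin s) (V : Matrix (Fin n) (Fin q) ℝ)
    (hV : Vᵀ * V = 1) (hq : 0 < q) : ∑ i, blockProb blk V i = 1 := by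
  have h1 : ∀ i, blockLeverage blk V i = ∑ t, ∑ a, (Vᵀ * blockId blk i) t a ^ 2 := fun i =>
    Real.sq_sqrt (Finset.sum_nonneg fun _ _ => Finset.sum_nonneg fun _ _ => sq_nonneg _)
  have h2 : ∀ t (x : Fin G × Fin s), (Vᵀ * blockId blk x.1) t x.2 ^ 2 =
      ∑ l, if blk l = x then V l t ^ 2 else 0 := by
    intro t x
    simp only [Matrix.mul_apply, blockId, transpose_apply, Prod.mk.eta, mul_ite, mul_one, mul_zero]
    by_cases hx : ∃ l, blk l = x
    · obtain ⟨l, rfl⟩ := hx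
      simp
    · push Not at hx
      simp [hx]
  have h3 : ∀ t, ∑ l, V l t ^ 2 = 1 := by
    intro t
    have := congrFun (congrFun hV t) t
    simpa [Matrix.mul_apply, sq] using this
  have h4 : ∑ i, blockLeverage blk V i = q := by
    simp only [h1]
    rw [Finset.sum_comm]
    have : ∀ t, ∑ i, ∑ a, (Vᵀ * blockId blk i) t a ^ 2 = 1 := by
      intro t
      rw [← Fintype.sum_prod_type' (fun i a => (Vᵀ * blockId blk i) t a ^ 2)]
      simp only [h2]
      rw [Finset.sum_comm]
      simpa using h3 t
    simp [this]
  have hq' : (q : ℝ) ≠ 0 := by positivity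
  simp only [blockProb]
  rw [← Finset.sum_div, h4, div_self hq']

/-- The block stable rank `min_i ‖Vᵀ E_i‖_F² / ‖Vᵀ E_i‖₂²`, the minimum being over the blocks for
which the quotient is defined. -/
def blockStableRank {n q G s : ℕ} (blk : Fin n ↪ Fin G × Fin s) (V : Matrix (Fin n) (Fin q) ℝ) :
    ℝ :=
  ⨅ i : {i : Fin G // Vᵀ * blockId blk i ≠ 0},
    frobNorm (Vᵀ * blockId blk i.1) ^ 2 / specNorm (Vᵀ * blockId blk i.1) ^ 2

/-- The column block sampling matrix `S`, an `n × g s` matrix whose `t`-th block of columns is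
`E_{J t} / √(g p_{J t})`. -/
def blockSamplingMatrix {n G s g : ℕ} (blk : Fin n ↪ Fin G × Fin s) (p : Fin G → ℝ)
    (J : Fin g → Fin G) : Matrix (Fin n) (Fin g × Fin s) ℝ :=
  fun l x => blockId blk (J x.1) l x.2 / Real.sqrt ((g : ℝ) * p (J x.1))

/-- The CUR approximation `C U R` computed from sampled rows `R` and a sampling matrix `S`:
`C = A S`, `W = R S`, `U = W†`. -/
def curApprox {m n r g s : ℕ} (A : Matrix (Fin m) (Fin n) ℝ) (R : Matrix (Fin r) (Fin n) ℝ)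
    (S : Matrix (Fin n) (Fin g × Fin s) ℝ) : Matrix (Fin m) (Fin n) ℝ :=
  (A * S) * pinv (R * S) * R

/-- The expectation of `f (x 0, …, x (N-1))` for independent `x t` in a finite set, each with
distribution `p`. -/
def iidExp {ι : Type*} [Fintype ι] (p : ι → ℝ) (N : ℕ) (f : (Fin N → ι) → ℝ) : ℝ :=
  ∑ x : Fin N → ι, (∏ t, p (x t)) * f x

open Classical in
/-- The probability that the output of the block CUR algorithm satisfies
`‖A - C U R‖_F ≤ bound`. First `r` row indices are drawn independently and uniformly. Then, given
the sampled rows `R`, right singular vectors `F I` of `R` and a number `g I` of blocks, `g I`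
blocks are drawn independently with the block leverage probabilities. -/
def successProb {m n r G s : ℕ} (A : Matrix (Fin m) (Fin n) ℝ) (blk : Fin n ↪ Fin G × Fin s)
    (F : ∀ I : Fin r → Fin m, TopRightSingular (rowSample A I)) (g : (Fin r → Fin m) → ℕ)
    (bound : ℝ) : ℝ :=
  iidExp (fun _ : Fin m => 1 / (m : ℝ)) r fun I =>
    iidExp (blockProb blk (F I).V) (g I) fun J =>
      if frobNorm (A - curApprox A (rowSample A I)
        (blockSamplingMatrix blk (blockProb blk (F I).V) J)) ≤ bound then 1 else 0

end BlockCUR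

end

/-!
The error of the algorithm is controlled in two steps, one for the sampled rows and one for the
sampled columns; each is a least squares problem solved from a random sketch.

*Rows.* Write `A = U_k Y + B` with `U_kᵀ B = 0`, and let `S` be the row sampling matrix. If
`U_kᵀ S Sᵀ U_k` is close to the identity and `U_kᵀ S Sᵀ B` is small, then the solution of the
sketched problem gives a matrix `X` for which `X R` is nearly as close to `A` as `A_k` is
(`exists_row_regression`).

*Columns.* Let `P` be the orthogonal projection onto the row space of `R`, so that `A P` is the best
approximation of the form `X R`, and put `B = A - A P`. If `V_Rᵀ S Sᵀ V_R` is close to the identity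
and `B S Sᵀ V_R` is close to `B V_R`, then the output `A S (R S)† R` is nearly as close to `A` as
`A P` is (`IsSVD.frobNorm_sub_curApprox_le`). Zero singular values of `R` do no harm: `B V_R` does
not vanish on the corresponding columns, but those are projected away.

All these closeness conditions compare a sampled matrix product with the true one. The sampled
product is an average of independent random matrices with the right mean, so its expected squared
Frobenius distance to the mean is bounded by the second moment of one term
(`iidExp_frobNorm_average_sub_sq_le`). The incoherence bounds this second moment for the rows
(`rowSampling_product_error`), and the block stable rank for the blocks
(`blockSampling_product_error`). Since the numbers of samples grow like `k ^ 2` and `r ^ 2`,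
Frobenius norms suffice throughout, no matrix concentration is needed, and Markov's inequality gives
probability `0.9` for each step; the steps have total success probability at least `0.81`.
-/

namespace BlockCUR

open scoped Matrix
open Matrix

/-! ### The Frobenius norm -/

section Frobenius

variable {α β γ : Type*} [Fintype α] [Fintype β] [Fintype γ]

open scoped Matrix.Norms.Frobenius in
theorem frobNorm_eq_norm (M : Matrix α β ℝ) : frobNorm M = ‖M‖ := by
  rw [frobNorm, frobenius_norm_def, Real.sqrt_eq_rpow]
  simp

theorem frobNorm_nonneg (M : Matrix α β ℝ) : 0 ≤ frobNorm M := Real.sqrt_nonneg _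

theorem frobNorm_sq (M : Matrix α β ℝ) : frobNorm M ^ 2 = ∑ i, ∑ j, M i j ^ 2 :=
  Real.sq_sqrt (Finset.sum_nonneg fun _ _ => Finset.sum_nonneg fun _ _ => sq_nonneg _)

theorem frobNorm_sub_le (M N : Matrix α β ℝ) : frobNorm (M - N) ≤ frobNorm M + frobNorm N := by
  simp only [frobNorm_eq_norm]
  exact @norm_sub_le _ frobeniusSeminormedAddCommGroup.toSeminormedAddGroup M N

theorem frobNorm_mul_le (M : Matrix α β ℝ) (N : Matrix β γ ℝ) :
    frobNorm (M * N) ≤ frobNorm M * frobNorm N := by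
  simp only [frobNorm_eq_norm]
  exact frobenius_norm_mul M N

theorem frobNorm_transpose (M : Matrix α β ℝ) : frobNorm Mᵀ = frobNorm M := by
  rw [frobNorm, frobNorm, Finset.sum_comm]
  rfl

theorem frobNorm_sq_eq_trace (M : Matrix α β ℝ) : frobNorm M ^ 2 = (M * Mᵀ).trace := by
  rw [frobNorm_sq]
  simp [trace, mul_apply, sq]

theorem frobNorm_sq_of_transpose_mul_self_eq_one [DecidableEq β] {M : Matrix α β ℝ}
    (hM : Mᵀ * M = 1) : frobNorm M ^ 2 = Fintype.card β := by
  rw [frobNorm_sq_eq_trace, trace_mul_comm, hM, trace_one]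

/-- Multiplication by a matrix with orthonormal columns is an isometry. -/
theorem frobNorm_mul_of_transpose_mul_self_eq_one [DecidableEq β] {M : Matrix α β ℝ}
    (hM : Mᵀ * M = 1) (N : Matrix β γ ℝ) : frobNorm (M * N) = frobNorm N := by
  have h : frobNorm (M * N) ^ 2 = frobNorm N ^ 2 := by
    rw [frobNorm_sq_eq_trace, frobNorm_sq_eq_trace, trace_mul_comm, transpose_mul,
      Matrix.mul_assoc, ← Matrix.mul_assoc Mᵀ, hM, Matrix.one_mul, trace_mul_comm]
  exact (sq_eq_sq₀ (frobNorm_nonneg _) (frobNorm_nonneg _)).1 h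

/-- Multiplication by an orthogonal projection does not increase the Frobenius norm. -/
theorem frobNorm_mul_projection_le [DecidableEq β] {Q : Matrix β β ℝ} (hQT : Qᵀ = Q)
    (hQQ : Q * Q = Q) (M : Matrix α β ℝ) : frobNorm (M * Q) ≤ frobNorm M := by
  have h1 : ∀ Q' : Matrix β β ℝ, Q'ᵀ = Q' → Q' * Q' = Q' →
      frobNorm (M * Q') ^ 2 = (M * Q' * Mᵀ).trace := by
    intro Q' h h'
    rw [frobNorm_sq_eq_trace, transpose_mul, h, Matrix.mul_assoc, ← Matrix.mul_assoc Q', h',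
      ← Matrix.mul_assoc]
  have h2 := h1 Q hQT hQQ
  have h3 := h1 (1 - Q) (by simp [hQT]) (by
    simp [Matrix.mul_sub, Matrix.sub_mul, hQQ])
  have h4 : frobNorm M ^ 2 = frobNorm (M * Q) ^ 2 + frobNorm (M * (1 - Q)) ^ 2 := by
    rw [h2, h3, frobNorm_sq_eq_trace, ← trace_add, ← Matrix.add_mul, ← Matrix.mul_add]
    simp
  exact (sq_le_sq₀ (frobNorm_nonneg _) (frobNorm_nonneg _)).1
    (by nlinarith [sq_nonneg (frobNorm (M * (1 - Q)))])

theorem frobNorm_smul_sq (c : ℝ) (M : Matrix α β ℝ) :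
    frobNorm (c • M) ^ 2 = c ^ 2 * frobNorm M ^ 2 := by
  simp only [frobNorm_sq, Matrix.smul_apply, smul_eq_mul, mul_pow, Finset.mul_sum]

theorem frobNorm_eq_zero {M : Matrix α β ℝ} (h : frobNorm M = 0) : M = 0 := by
  rw [frobNorm_eq_norm] at h
  exact (@norm_eq_zero _ frobeniusNormedAddCommGroup.toNormedAddGroup M).1 h

open scoped Matrix.Norms.L2Operator in
theorem frobNorm_mul_transpose_le_specNorm [DecidableEq β] (X : Matrix γ β ℝ) (Y : Matrix α β ℝ) :
    frobNorm (X * Yᵀ) ^ 2 ≤ frobNorm X ^ 2 * specNorm Y ^ 2 := by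
  rw [frobNorm_sq, frobNorm_sq, Finset.sum_mul]
  refine Finset.sum_le_sum fun i _ => ?_
  have h := l2_opNorm_mulVec Y (WithLp.toLp 2 (X i))
  have h2 := pow_le_pow_left₀ (norm_nonneg _) h 2
  rw [mul_pow, EuclideanSpace.norm_sq_eq, EuclideanSpace.norm_sq_eq] at h2
  simp only [Real.norm_eq_abs, sq_abs] at h2
  rw [mul_comm, specNorm]
  refine le_trans (le_of_eq ?_) h2
  refine Finset.sum_congr rfl fun j _ => ?_
  simp [mul_apply, mulVec, dotProduct, mul_comm]

open scoped Matrix.Norms.L2Operator in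
theorem specNorm_eq_zero [DecidableEq β] {M : Matrix α β ℝ} : specNorm M = 0 ↔ M = 0 :=
  norm_eq_zero

/-- An a priori bound for solutions of `(1 + E) L = M`, used in place of a bound for the inverse of
`1 + E`. -/
theorem frobNorm_le_two_mul {E : Matrix α α ℝ} (hE : frobNorm E ≤ 1 / 2) {L M : Matrix α β ℝ}
    (h : L = M - E * L) : frobNorm L ≤ 2 * frobNorm M := by
  have h1 : frobNorm L ≤ frobNorm M + frobNorm (E * L) := by
    conv_lhs => rw [h]
    exact frobNorm_sub_le _ _
  have h2 : frobNorm (E * L) ≤ 1 / 2 * frobNorm L :=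
    (frobNorm_mul_le _ _).trans (mul_le_mul_of_nonneg_right hE (frobNorm_nonneg _))
  linarith

theorem isUnit_of_frobNorm_sub_one_le [DecidableEq α] {G : Matrix α α ℝ}
    (h : frobNorm (G - 1) ≤ 1 / 2) : IsUnit G := by
  rw [← Matrix.mulVec_injective_iff_isUnit, ← Matrix.coe_mulVecLin,
    ← LinearMap.ker_eq_bot, LinearMap.ker_eq_bot']
  intro x hx
  have hx : G *ᵥ x = 0 := hx
  set M : Matrix α (Fin 1) ℝ := fun i _ => x i
  have hM : G * M = 0 := by
    ext i j
    exact congrFun hx i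
  have h1 : M = 0 - (G - 1) * M := by rw [Matrix.sub_mul, hM]; simp
  have h2 := frobNorm_le_two_mul h h1
  have h3 : M = 0 := frobNorm_eq_zero (le_antisymm (by simpa [frobNorm] using h2)
    (frobNorm_nonneg _))
  ext i
  exact congrFun (congrFun h3 i) 0

end Frobenius

/-! ### Independent sampling from a finite distribution -/

section Sampling

variable {ι : Type*} [Fintype ι] {p : ι → ℝ}

theorem iidExp_succ (p : ι → ℝ) (N : ℕ) (f : (Fin (N + 1) → ι) → ℝ) :
    iidExp p (N + 1) f = ∑ i, p i * iidExp p N fun x => f (Fin.cons i x) := by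
  unfold iidExp
  rw [← (Fin.consEquiv fun _ => ι).sum_comp, Fintype.sum_prod_type]
  refine Finset.sum_congr rfl fun i _ => ?_
  rw [Finset.mul_sum]
  refine Finset.sum_congr rfl fun x _ => ?_
  simp [Fin.consEquiv, Fin.prod_univ_succ, mul_assoc]

theorem iidExp_mono (hp : ∀ i, 0 ≤ p i) {N : ℕ} {f h : (Fin N → ι) → ℝ} (hfh : ∀ x, f x ≤ h x) :
    iidExp p N f ≤ iidExp p N h :=
  Finset.sum_le_sum fun x _ =>
    mul_le_mul_of_nonneg_left (hfh x) (Finset.prod_nonneg fun t _ => hp (x t))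

theorem iidExp_add (p : ι → ℝ) {N : ℕ} (f h : (Fin N → ι) → ℝ) :
    iidExp p N (fun x => f x + h x) = iidExp p N f + iidExp p N h := by
  simp [iidExp, mul_add, Finset.sum_add_distrib]

theorem iidExp_const_mul (p : ι → ℝ) {N : ℕ} (c : ℝ) (f : (Fin N → ι) → ℝ) :
    iidExp p N (fun x => c * f x) = c * iidExp p N f := by
  simp only [iidExp, Finset.mul_sum]
  exact Finset.sum_congr rfl fun x _ => by ring

theorem iidExp_sum (p : ι → ℝ) {N : ℕ} {κ : Type*} (s : Finset κ) (f : κ → (Fin N → ι) → ℝ) :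
    iidExp p N (fun x => ∑ a ∈ s, f a x) = ∑ a ∈ s, iidExp p N (f a) := by
  simp only [iidExp, Finset.mul_sum]
  exact Finset.sum_comm

theorem iidExp_const (hp1 : ∑ i, p i = 1) (N : ℕ) (c : ℝ) : iidExp p N (fun _ => c) = c := by
  induction N with
  | zero => simp [iidExp]
  | succ N ih => rw [iidExp_succ, ih, ← Finset.sum_mul, hp1, one_mul]

theorem iidExp_sum_eq_zero (hp1 : ∑ i, p i = 1) {w : ι → ℝ} (hw : ∑ i, p i * w i = 0) (N : ℕ) :
    iidExp p N (fun x => ∑ t, w (x t)) = 0 := by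
  induction N with
  | zero => simp [iidExp]
  | succ N ih =>
    simp [iidExp_succ, Fin.sum_univ_succ, iidExp_add, iidExp_const hp1, ih, hw]

theorem iidExp_sum_sq (hp1 : ∑ i, p i = 1) {w : ι → ℝ} (hw : ∑ i, p i * w i = 0) (N : ℕ) :
    iidExp p N (fun x => (∑ t, w (x t)) ^ 2) = N * ∑ i, p i * w i ^ 2 := by
  induction N with
  | zero => simp [iidExp]
  | succ N ih =>
    have h : ∀ i, iidExp p N (fun x => (∑ t, w ((Fin.cons i x : Fin (N + 1) → ι) t)) ^ 2) =
        w i ^ 2 + N * ∑ i, p i * w i ^ 2 := by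
      intro i
      have h1 : (fun x : Fin N → ι => (∑ t, w ((Fin.cons i x : Fin (N + 1) → ι) t)) ^ 2) =
          fun x => (w i ^ 2 + 2 * w i * ∑ t, w (x t)) + (∑ t, w (x t)) ^ 2 := by
        funext x
        simp only [Fin.sum_univ_succ, Fin.cons_zero, Fin.cons_succ]
        ring
      rw [h1, iidExp_add, iidExp_add, iidExp_const hp1, iidExp_const_mul,
        iidExp_sum_eq_zero hp1 hw, ih]
      ring
    rw [iidExp_succ]
    simp only [h, mul_add, Finset.sum_add_distrib, ← Finset.sum_mul, hp1]
    push_cast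
    ring

theorem iidExp_average_sub_sq_le (hp1 : ∑ i, p i = 1) {N : ℕ}
    (hN : 0 < N) (z : ι → ℝ) :
    iidExp p N (fun x => ((1 / (N : ℝ)) * ∑ t, z (x t) - ∑ i, p i * z i) ^ 2) ≤
      1 / N * ∑ i, p i * z i ^ 2 := by
  have hN' : (0 : ℝ) < N := by exact_mod_cast hN
  set c := ∑ i, p i * z i with hc
  have hw : ∑ i, p i * (z i - c) = 0 := by
    simp [mul_sub, Finset.sum_sub_distrib, ← Finset.sum_mul, hp1, hc]
  have h1 : (fun x : Fin N → ι => ((1 / (N : ℝ)) * ∑ t, z (x t) - c) ^ 2) =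
      fun x => (1 / (N : ℝ)) ^ 2 * (∑ t, (z (x t) - c)) ^ 2 := by
    funext x
    rw [Finset.sum_sub_distrib]
    simp
    field_simp
  have h2 : ∑ i, p i * (z i - c) ^ 2 = ∑ i, p i * z i ^ 2 - c ^ 2 := by
    have : ∀ i, p i * (z i - c) ^ 2 = p i * z i ^ 2 - 2 * c * (p i * z i) + p i * c ^ 2 :=
      fun i => by ring
    simp only [this, Finset.sum_add_distrib, Finset.sum_sub_distrib, ← Finset.mul_sum,
      ← Finset.sum_mul, hp1, ← hc]
    ring
  rw [h1, iidExp_const_mul, iidExp_sum_sq hp1 hw, h2]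
  have h3 : (1 / (N : ℝ)) ^ 2 * (N * (∑ i, p i * z i ^ 2 - c ^ 2)) =
      1 / N * (∑ i, p i * z i ^ 2 - c ^ 2) := by field_simp
  rw [h3]
  exact mul_le_mul_of_nonneg_left (by nlinarith [sq_nonneg c]) (by positivity)

/-- The second-moment bound behind both sampling steps: the average of `N` independent random
matrices deviates from their mean by at most `1 / N` times the second moment of one of them. -/
theorem iidExp_frobNorm_average_sub_sq_le (hp1 : ∑ i, p i = 1)
    {N : ℕ} (hN : 0 < N) {α β : Type*} [Fintype α] [Fintype β] (z : ι → Matrix α β ℝ) :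
    iidExp p N (fun x => frobNorm ((1 / (N : ℝ)) • ∑ t, z (x t) - ∑ i, p i • z i) ^ 2) ≤
      1 / N * ∑ i, p i * frobNorm (z i) ^ 2 := by
  have h : ∑ i, p i * frobNorm (z i) ^ 2 = ∑ a, ∑ b, ∑ i, p i * z i a b ^ 2 := by
    simp only [frobNorm_sq, Finset.mul_sum]
    rw [Finset.sum_comm]
    exact Finset.sum_congr rfl fun a _ => Finset.sum_comm
  rw [h]
  simp only [frobNorm_sq, iidExp_sum]
  rw [Finset.mul_sum]
  refine Finset.sum_le_sum fun a _ => ?_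
  rw [Finset.mul_sum]
  refine Finset.sum_le_sum fun b _ => ?_
  simpa [Matrix.sum_apply] using iidExp_average_sub_sq_le hp1 hN fun i => z i a b

open Classical in
/-- Markov's inequality. The bound `a = 0` is allowed: then `X` vanishes almost surely. -/
theorem one_sub_le_iidExp_indicator (hp : ∀ i, 0 ≤ p i) (hp1 : ∑ i, p i = 1) {N : ℕ}
    {X : (Fin N → ι) → ℝ} (hX : ∀ x, 0 ≤ X x) {a δ : ℝ} (hδ : 0 ≤ δ) (ha : 0 ≤ a)
    (h : iidExp p N X ≤ δ * a) :
    1 - δ ≤ iidExp p N fun x => if X x ≤ a then 1 else 0 := by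
  rcases ha.eq_or_lt with rfl | ha
  · have h0 : ∀ x, (∏ t, p (x t)) * X x = 0 := by
      have h1 : ∀ x ∈ Finset.univ, 0 ≤ (∏ t, p (x t)) * X x := fun x _ =>
        mul_nonneg (Finset.prod_nonneg fun t _ => hp (x t)) (hX x)
      rw [mul_zero] at h
      intro x
      exact (Finset.sum_eq_zero_iff_of_nonneg h1).1 (le_antisymm h (Finset.sum_nonneg h1)) x
        (Finset.mem_univ x)
    have h2 : iidExp p N (fun x => if X x ≤ 0 then 1 else 0) = 1 := by
      refine Eq.trans ?_ (iidExp_const hp1 N 1)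
      refine Finset.sum_congr rfl fun x _ => ?_
      rcases mul_eq_zero.1 (h0 x) with h3 | h3 <;> simp [h3]
    rw [h2]
    linarith
  · have h1 := iidExp_mono (N := N) hp (f := fun x => 1 + (-(1 / a)) * X x)
      (h := fun x => if X x ≤ a then 1 else 0) (fun x => by
        have h3 : 0 ≤ 1 / a * X x := mul_nonneg (by positivity) (hX x)
        split_ifs with h2
        · linarith
        · have : 1 ≤ 1 / a * X x := by
            rw [one_div, inv_mul_eq_div, le_div_iff₀ ha]
            linarith [not_le.1 h2]
          linarith)
    rw [iidExp_add, iidExp_const hp1, iidExp_const_mul] at h1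
    have h2 : 1 / a * iidExp p N X ≤ 1 / a * (δ * a) :=
      mul_le_mul_of_nonneg_left h (by positivity)
    have h3 : 1 / a * (δ * a) = δ := by field_simp
    linarith

open Classical in
/-- The union bound for the failure of two events. -/
theorem le_iidExp_indicator_and (hp : ∀ i, 0 ≤ p i) (hp1 : ∑ i, p i = 1) {N : ℕ}
    {P Q : (Fin N → ι) → Prop} {a b : ℝ}
    (hP : 1 - a ≤ iidExp p N fun x => if P x then 1 else 0)
    (hQ : 1 - b ≤ iidExp p N fun x => if Q x then 1 else 0) :
    1 - (a + b) ≤ iidExp p N fun x => if P x ∧ Q x then 1 else 0 := by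
  have h := iidExp_mono (N := N) hp
    (f := fun x => ((if P x then 1 else 0) + (if Q x then 1 else 0)) + -1)
    (h := fun x => if P x ∧ Q x then 1 else 0) (fun x => by
      by_cases h1 : P x <;> by_cases h2 : Q x <;> simp [h1, h2])
  rw [iidExp_add, iidExp_add, iidExp_const hp1] at h
  linarith

end Sampling

/-! ### Row sampling -/

theorem rowSamplingMatrix_transpose_mul_apply {m r a : ℕ} (I : Fin r → Fin m)
    (Y : Matrix (Fin m) (Fin a) ℝ) (t : Fin r) (j : Fin a) :
    ((rowSamplingMatrix I)ᵀ * Y) t j = 1 / Real.sqrt ((r : ℝ) * (1 / (m : ℝ))) * Y (I t) j := by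
  simp [mul_apply, rowSamplingMatrix]

theorem rowSampled_product_eq_average {m r a b : ℕ} (I : Fin r → Fin m)
    (Y : Matrix (Fin m) (Fin a) ℝ) (X : Matrix (Fin m) (Fin b) ℝ) :
    ((rowSamplingMatrix I)ᵀ * Y)ᵀ * ((rowSamplingMatrix I)ᵀ * X) =
      (1 / (r : ℝ)) • ∑ t, (m : ℝ) • vecMulVec (Y (I t)) (X (I t)) := by
  have hs : (1 / Real.sqrt ((r : ℝ) * (1 / (m : ℝ)))) ^ 2 = 1 / (r : ℝ) * m := by
    rw [div_pow, Real.sq_sqrt (by positivity)]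
    simp
    ring
  ext i j
  rw [mul_apply]
  simp only [transpose_apply, rowSamplingMatrix_transpose_mul_apply, Matrix.smul_apply,
    Matrix.sum_apply, vecMulVec_apply, smul_eq_mul, Finset.mul_sum]
  refine Finset.sum_congr rfl fun t _ => ?_
  rw [← mul_assoc (1 / (r : ℝ)), ← hs]
  ring

theorem frobNorm_vecMulVec_sq {α β : Type*} [Fintype α] [Fintype β] (u : α → ℝ) (v : β → ℝ) :
    frobNorm (vecMulVec u v) ^ 2 = (∑ i, u i ^ 2) * ∑ j, v j ^ 2 := by
  simp [frobNorm_sq, vecMulVec_apply, mul_pow, Finset.sum_mul_sum]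

/-- Uniform row sampling approximates a product `Yᵀ X` if the rows of `Y` have comparable norms. -/
theorem rowSampling_product_error {m r a b : ℕ} (hm : 0 < m) (hr : 0 < r)
    (Y : Matrix (Fin m) (Fin a) ℝ) (X : Matrix (Fin m) (Fin b) ℝ) {c : ℝ}
    (hY : ∀ i, m * ∑ j, Y i j ^ 2 ≤ c) :
    iidExp (fun _ : Fin m => 1 / (m : ℝ)) r (fun I =>
      frobNorm (((rowSamplingMatrix I)ᵀ * Y)ᵀ * ((rowSamplingMatrix I)ᵀ * X) - Yᵀ * X) ^ 2) ≤
      c / r * frobNorm X ^ 2 := by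
  have hm' : (0 : ℝ) < m := by exact_mod_cast hm
  have h := iidExp_frobNorm_average_sub_sq_le (p := fun _ : Fin m => 1 / (m : ℝ))
    (by simp [hm'.ne']) hr (fun i => (m : ℝ) • vecMulVec (Y i) (X i))
  have hmean : ∑ i, (1 / (m : ℝ)) • ((m : ℝ) • vecMulVec (Y i) (X i)) = Yᵀ * X := by
    ext i j
    simp only [smul_smul, one_div_mul_cancel hm'.ne', one_smul, Matrix.sum_apply, vecMulVec_apply,
      mul_apply, transpose_apply]
  rw [hmean] at h
  simp only [rowSampled_product_eq_average]
  refine h.trans ?_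
  rw [frobNorm_sq X, Finset.mul_sum, Finset.mul_sum]
  refine Finset.sum_le_sum fun i _ => ?_
  rw [frobNorm_smul_sq, frobNorm_vecMulVec_sq]
  have h0 : 0 ≤ ∑ j, X i j ^ 2 := Finset.sum_nonneg fun _ _ => sq_nonneg _
  calc 1 / (r : ℝ) * (1 / m * (m ^ 2 * ((∑ j, Y i j ^ 2) * ∑ j, X i j ^ 2)))
      = (m * ∑ j, Y i j ^ 2) * ((∑ j, X i j ^ 2) / r) := by field_simp
    _ ≤ c * ((∑ j, X i j ^ 2) / r) :=
        mul_le_mul_of_nonneg_right (hY i) (by positivity)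
    _ = c / r * ∑ j, X i j ^ 2 := by ring

/-! ### Block sampling -/

section Block

variable {n q G s : ℕ} {blk : Fin n ↪ Fin G × Fin s} {V : Matrix (Fin n) (Fin q) ℝ}

theorem mul_blockSamplingMatrix_apply {a g : ℕ} (p : Fin G → ℝ) (J : Fin g → Fin G)
    (X : Matrix (Fin a) (Fin n) ℝ) (i : Fin a) (x : Fin g × Fin s) :
    (X * blockSamplingMatrix blk p J) i x =
      (X * blockId blk (J x.1)) i x.2 / Real.sqrt ((g : ℝ) * p (J x.1)) := by
  simp [mul_apply, blockSamplingMatrix, Finset.sum_div, mul_div_assoc]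

theorem blockSampled_product_eq_average {a b g : ℕ} {p : Fin G → ℝ} (hp : ∀ i, 0 ≤ p i)
    (J : Fin g → Fin G) (X : Matrix (Fin a) (Fin n) ℝ) (Y : Matrix (Fin b) (Fin n) ℝ) :
    (X * blockSamplingMatrix blk p J) * (Y * blockSamplingMatrix blk p J)ᵀ =
      (1 / (g : ℝ)) • ∑ t, (p (J t))⁻¹ • ((X * blockId blk (J t)) * (Y * blockId blk (J t))ᵀ) := by
  ext i j
  rw [mul_apply]
  simp only [transpose_apply, mul_blockSamplingMatrix_apply, Matrix.smul_apply,
    Matrix.sum_apply, smul_eq_mul, Finset.mul_sum, Fintype.sum_prod_type]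
  refine Finset.sum_congr rfl fun t _ => ?_
  rw [mul_apply, Finset.mul_sum, Finset.mul_sum]
  refine Finset.sum_congr rfl fun l _ => ?_
  rw [transpose_apply, div_mul_div_comm, Real.mul_self_sqrt (mul_nonneg (by positivity) (hp _)),
    one_div, div_eq_mul_inv, mul_inv]
  ring

/-- The blocks partition the columns, so a product splits into the contributions of the blocks. -/
theorem sum_blockId_product {a b : ℕ} (X : Matrix (Fin a) (Fin n) ℝ)
    (Y : Matrix (Fin b) (Fin n) ℝ) :
    ∑ i, (X * blockId blk i) * (Y * blockId blk i)ᵀ = X * Yᵀ := by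
  have h : ∑ i, blockId blk i * (blockId blk i)ᵀ = (1 : Matrix (Fin n) (Fin n) ℝ) := by
    ext l l'
    simp only [Matrix.sum_apply, mul_apply, transpose_apply, blockId]
    rw [← Fintype.sum_prod_type' (fun i a => (if blk l = (i, a) then (1 : ℝ) else 0) *
      (if blk l' = (i, a) then 1 else 0))]
    simp only [Prod.mk.eta]
    rw [Finset.sum_eq_single (blk l)]
    · by_cases hl : l = l'
      · subst hl
        simp [Matrix.one_apply_eq]
      · have : blk l' ≠ blk l := fun h => hl (blk.injective h).symm
        simp [this, Matrix.one_apply_ne hl]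
    · intro x _ hx
      simp [hx.symm]
    · simp
  calc ∑ i, (X * blockId blk i) * (Y * blockId blk i)ᵀ
      = X * (∑ i, blockId blk i * (blockId blk i)ᵀ) * Yᵀ := by
        simp only [Matrix.mul_sum, Matrix.sum_mul, transpose_mul, Matrix.mul_assoc]
    _ = X * Yᵀ := by rw [h, Matrix.mul_one]

theorem sum_frobNorm_mul_blockId_sq {a : ℕ} (X : Matrix (Fin a) (Fin n) ℝ) :
    ∑ i, frobNorm (X * blockId blk i) ^ 2 = frobNorm X ^ 2 := by
  simp only [frobNorm_sq_eq_trace]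
  rw [← trace_sum, sum_blockId_product]

theorem blockLeverage_nonneg (i : Fin G) : 0 ≤ blockLeverage blk V i := sq_nonneg _

theorem blockProb_nonneg (i : Fin G) : 0 ≤ blockProb blk V i :=
  div_nonneg (blockLeverage_nonneg i) (Nat.cast_nonneg q)

theorem transpose_mul_blockId_eq_zero (hq : 0 < q) {i : Fin G} (h : blockProb blk V i = 0) :
    Vᵀ * blockId blk i = 0 := by
  have hq' : (q : ℝ) ≠ 0 := by positivity
  have h1 : frobNorm (Vᵀ * blockId blk i) ^ 2 = 0 := by
    simpa [blockProb, blockLeverage, hq'] using h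
  exact frobNorm_eq_zero (by simpa using h1)

theorem blockStableRank_mul_specNorm_sq_le (i : Fin G) :
    blockStableRank blk V * specNorm (Vᵀ * blockId blk i) ^ 2 ≤ blockLeverage blk V i := by
  by_cases h : Vᵀ * blockId blk i = 0
  · have : specNorm (Vᵀ * blockId blk i) = 0 := specNorm_eq_zero.2 h
    rw [this]
    simpa using blockLeverage_nonneg i
  · have h1 : 0 < specNorm (Vᵀ * blockId blk i) ^ 2 := by
      have : specNorm (Vᵀ * blockId blk i) ≠ 0 := fun h' => h (specNorm_eq_zero.1 h')
      positivity
    rw [← le_div_iff₀ h1]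
    exact ciInf_le ⟨0, by rintro _ ⟨i, rfl⟩; positivity⟩
      (⟨i, h⟩ : {i : Fin G // Vᵀ * blockId blk i ≠ 0})

theorem blockStableRank_pos (hV : Vᵀ * V = 1) (hq : 0 < q) : 0 < blockStableRank blk V := by
  have hne : Nonempty {i : Fin G // Vᵀ * blockId blk i ≠ 0} := by
    by_contra hcon
    have h0 : ∀ i, Vᵀ * blockId blk i = 0 := fun i => by
      by_contra h
      exact hcon ⟨⟨i, h⟩⟩
    have h1 := sum_blockId_product (blk := blk) Vᵀ Vᵀ
    rw [transpose_transpose, hV] at h1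
    simp only [h0, Matrix.zero_mul, Finset.sum_const_zero] at h1
    simpa using congrFun (congrFun h1 ⟨0, hq⟩) ⟨0, hq⟩
  obtain ⟨i, hi⟩ := exists_eq_ciInf_of_finite
    (f := fun i : {i : Fin G // Vᵀ * blockId blk i ≠ 0} =>
      frobNorm (Vᵀ * blockId blk i.1) ^ 2 / specNorm (Vᵀ * blockId blk i.1) ^ 2)
  rw [blockStableRank, ← hi]
  have h2 : frobNorm (Vᵀ * blockId blk i.1) ≠ 0 := fun h => i.2 (frobNorm_eq_zero h)
  have h3 : specNorm (Vᵀ * blockId blk i.1) ≠ 0 := fun h => i.2 (specNorm_eq_zero.1 h)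
  positivity

/-- Block leverage score sampling approximates a product `X V`. The block stable rank enters
because the variance contributed by block `i` is at most
`‖X E_i‖_F² ‖Vᵀ E_i‖₂² / p_i ≤ (q / α) ‖X E_i‖_F²`. -/
theorem blockSampling_product_error {a g : ℕ} (hV : Vᵀ * V = 1) (hq : 0 < q) (hg : 0 < g)
    (X : Matrix (Fin a) (Fin n) ℝ) :
    iidExp (blockProb blk V) g (fun J =>
      frobNorm ((X * blockSamplingMatrix blk (blockProb blk V) J) *
        (Vᵀ * blockSamplingMatrix blk (blockProb blk V) J)ᵀ - X * V) ^ 2) ≤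
      q / (g * blockStableRank blk V) * frobNorm X ^ 2 := by
  have hα := blockStableRank_pos (blk := blk) hV hq
  have h := iidExp_frobNorm_average_sub_sq_le (sum_blockProb blk V hV hq) hg
    (fun i => (blockProb blk V i)⁻¹ • ((X * blockId blk i) * (Vᵀ * blockId blk i)ᵀ))
  have hmean : ∑ i, blockProb blk V i • ((blockProb blk V i)⁻¹ •
      ((X * blockId blk i) * (Vᵀ * blockId blk i)ᵀ)) = X * V := by
    have h2 := sum_blockId_product (blk := blk) X Vᵀ
    rw [transpose_transpose] at h2
    rw [← h2]
    refine Finset.sum_congr rfl fun i _ => ?_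
    by_cases hi : blockProb blk V i = 0
    · rw [transpose_mul_blockId_eq_zero hq hi]
      simp
    · rw [smul_smul, mul_inv_cancel₀ hi, one_smul]
  rw [hmean] at h
  simp only [blockSampled_product_eq_average blockProb_nonneg]
  refine h.trans ?_
  rw [← sum_frobNorm_mul_blockId_sq (blk := blk) X, Finset.mul_sum, Finset.mul_sum]
  refine Finset.sum_le_sum fun i _ => ?_
  rw [frobNorm_smul_sq]
  have hg' : (0 : ℝ) < g := by exact_mod_cast hg
  have hq' : (0 : ℝ) < q := by exact_mod_cast hq
  by_cases hi : blockProb blk V i = 0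
  · rw [hi]
    simp only [zero_mul, mul_zero]
    positivity
  have hpi : 0 < blockProb blk V i := lt_of_le_of_ne (blockProb_nonneg i) (Ne.symm hi)
  have h1 := frobNorm_mul_transpose_le_specNorm (X * blockId blk i) (Vᵀ * blockId blk i)
  have h2 := blockStableRank_mul_specNorm_sq_le (blk := blk) (V := V) i
  have h3 : blockLeverage blk V i = q * blockProb blk V i := by
    rw [blockProb]; field_simp
  have h4 : specNorm (Vᵀ * blockId blk i) ^ 2 ≤ q * blockProb blk V i / blockStableRank blk V := by
    rw [le_div_iff₀ hα, ← h3, mul_comm]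
    exact h2
  calc 1 / (g : ℝ) * (blockProb blk V i * ((blockProb blk V i)⁻¹ ^ 2 *
        frobNorm ((X * blockId blk i) * (Vᵀ * blockId blk i)ᵀ) ^ 2))
      = 1 / (g : ℝ) * (blockProb blk V i)⁻¹ *
        frobNorm ((X * blockId blk i) * (Vᵀ * blockId blk i)ᵀ) ^ 2 := by field_simp
    _ ≤ 1 / (g : ℝ) * (blockProb blk V i)⁻¹ * (frobNorm (X * blockId blk i) ^ 2 *
        (q * blockProb blk V i / blockStableRank blk V)) := by
        refine mul_le_mul_of_nonneg_left (h1.trans ?_) (by positivity)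
        exact mul_le_mul_of_nonneg_left h4 (by positivity)
    _ = q / (g * blockStableRank blk V) * frobNorm (X * blockId blk i) ^ 2 := by field_simp

end Block

/-! ### Error bounds for fixed samples -/

theorem frobNorm_eq_sqrt_of_transpose_mul_self_eq_one {n k : ℕ} {M : Matrix (Fin n) (Fin k) ℝ}
    (hM : Mᵀ * M = 1) : frobNorm M = Real.sqrt k := by
  rw [← Real.sqrt_sq (frobNorm_nonneg M), frobNorm_sq_of_transpose_mul_self_eq_one hM,
    Fintype.card_fin]

/-- The sketched least squares problem: if `S` almost preserves the geometry of the columns of `U`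
and their orthogonality to `B`, then the sampled rows of `U Y + B` almost reproduce `U Y`. -/
theorem exists_row_regression {m n r k : ℕ} (S : Matrix (Fin m) (Fin r) ℝ)
    {U : Matrix (Fin m) (Fin k) ℝ} (hU : Uᵀ * U = 1) (Y : Matrix (Fin k) (Fin n) ℝ)
    (B : Matrix (Fin m) (Fin n) ℝ) (hG : frobNorm ((Sᵀ * U)ᵀ * (Sᵀ * U) - 1) ≤ 1 / 2) :
    ∃ X : Matrix (Fin m) (Fin r) ℝ, frobNorm (U * Y + B - X * (Sᵀ * (U * Y + B))) ≤
      frobNorm B + 2 * Real.sqrt k * frobNorm ((Sᵀ * U)ᵀ * (Sᵀ * B)) := by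
  set H := Sᵀ * U with hH
  have hunit := (Matrix.isUnit_iff_isUnit_det _).1 (isUnit_of_frobNorm_sub_one_le hG)
  set K := (Hᵀ * H)⁻¹ with hK
  have hKH : K * (Hᵀ * H) = 1 := nonsing_inv_mul _ hunit
  have hHK : Hᵀ * H * K = 1 := mul_nonsing_inv _ hunit
  have hKn : frobNorm K ≤ 2 * Real.sqrt k := by
    have := frobNorm_le_two_mul hG (L := K) (M := 1) (by rw [Matrix.sub_mul, hHK]; simp)
    rwa [frobNorm_eq_sqrt_of_transpose_mul_self_eq_one
      (M := (1 : Matrix (Fin k) (Fin k) ℝ)) (by simp)] at this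
  refine ⟨U * K * Hᵀ, ?_⟩
  have h1 : U * Y + B - U * K * Hᵀ * (Sᵀ * (U * Y + B)) = B - U * (K * (Hᵀ * (Sᵀ * B))) := by
    have h2 : U * K * Hᵀ * (Sᵀ * (U * Y)) = U * Y := by
      calc U * K * Hᵀ * (Sᵀ * (U * Y)) = U * (K * (Hᵀ * H)) * Y := by
            simp only [hH, Matrix.mul_assoc]
        _ = U * Y := by rw [hKH, Matrix.mul_one]
    rw [Matrix.mul_add, Matrix.mul_add, h2]
    simp only [Matrix.mul_assoc]
    abel
  rw [h1]
  refine (frobNorm_sub_le _ _).trans (add_le_add_right ?_ _)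
  rw [frobNorm_mul_of_transpose_mul_self_eq_one hU]
  exact (frobNorm_mul_le _ _).trans (mul_le_mul_of_nonneg_right hKn (frobNorm_nonneg _))

/-- The indicator of the nonzero singular values, as a diagonal matrix. -/
noncomputable def singularSupport {q : ℕ} (σ : Fin q → ℝ) : Matrix (Fin q) (Fin q) ℝ :=
  diagonal fun t => if σ t = 0 then 0 else 1

/-- The orthogonal projection onto the row space of a matrix with right singular vectors `V` and
singular values `σ`. -/
noncomputable def rowSpaceProj {n q : ℕ} (σ : Fin q → ℝ) (V : Matrix (Fin n) (Fin q) ℝ) :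
    Matrix (Fin n) (Fin n) ℝ :=
  V * singularSupport σ * Vᵀ

section Regression

variable {m n r q : ℕ} {R : Matrix (Fin r) (Fin n) ℝ} {U : Matrix (Fin r) (Fin q) ℝ}
  {σ : Fin q → ℝ} {V : Matrix (Fin n) (Fin q) ℝ}

theorem singularSupport_transpose : (singularSupport σ)ᵀ = singularSupport σ :=
  diagonal_transpose _

theorem singularSupport_mul_self :
    singularSupport σ * singularSupport σ = singularSupport σ := by
  rw [singularSupport, diagonal_mul_diagonal]
  congr 1
  ext t
  split_ifs <;> simp

theorem singularSupport_mul_diagonal : singularSupport σ * diagonal σ = diagonal σ := by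
  rw [singularSupport, diagonal_mul_diagonal]
  congr 1
  ext t
  split_ifs with h <;> simp [h]

theorem diagonal_mul_singularSupport : diagonal σ * singularSupport σ = diagonal σ := by
  rw [singularSupport, diagonal_mul_diagonal]
  congr 1
  ext t
  split_ifs with h <;> simp [h]

theorem diagonal_inv_mul_diagonal :
    diagonal (fun t => (σ t)⁻¹) * diagonal σ = singularSupport σ := by
  rw [singularSupport, diagonal_mul_diagonal]
  congr 1
  ext t
  split_ifs with h <;> simp [h]

theorem rowSpaceProj_transpose : (rowSpaceProj σ V)ᵀ = rowSpaceProj σ V := by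
  simp [rowSpaceProj, transpose_mul, singularSupport_transpose, Matrix.mul_assoc]

theorem rowSpaceProj_mul (hV : Vᵀ * V = 1) :
    rowSpaceProj σ V * V = V * singularSupport σ := by
  rw [rowSpaceProj, Matrix.mul_assoc, hV, Matrix.mul_one]

theorem rowSpaceProj_mul_self (hV : Vᵀ * V = 1) :
    rowSpaceProj σ V * rowSpaceProj σ V = rowSpaceProj σ V := by
  calc rowSpaceProj σ V * rowSpaceProj σ V
      = rowSpaceProj σ V * V * singularSupport σ * Vᵀ := by
        conv_lhs => rhs; rw [rowSpaceProj]
        simp only [Matrix.mul_assoc]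
    _ = rowSpaceProj σ V := by
        rw [rowSpaceProj_mul hV, Matrix.mul_assoc V, singularSupport_mul_self, rowSpaceProj]

theorem IsSVD.mul_rowSpaceProj (h : IsSVD R U σ V) : R * rowSpaceProj σ V = R := by
  calc R * rowSpaceProj σ V
      = U * diagonal σ * (Vᵀ * V) * singularSupport σ * Vᵀ := by
        conv_lhs => lhs; rw [h.eq]
        simp only [rowSpaceProj, Matrix.mul_assoc]
    _ = R := by
        rw [h.orthonormal_right, Matrix.mul_one, Matrix.mul_assoc U, diagonal_mul_singularSupport,
          ← h.eq]

/-- The projection onto the row space of `R` gives the best approximation `X R` of `A`. -/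
theorem IsSVD.frobNorm_sub_rowSpaceProj_le (h : IsSVD R U σ V) (A : Matrix (Fin m) (Fin n) ℝ)
    (X : Matrix (Fin m) (Fin r) ℝ) :
    frobNorm (A - A * rowSpaceProj σ V) ≤ frobNorm (A - X * R) := by
  have h1 : A - A * rowSpaceProj σ V = (A - X * R) * (1 - rowSpaceProj σ V) := by
    rw [Matrix.mul_sub, Matrix.mul_one, Matrix.sub_mul, Matrix.mul_assoc X, h.mul_rowSpaceProj]
    abel
  rw [h1]
  refine frobNorm_mul_projection_le ?_ ?_ _
  · simp [rowSpaceProj_transpose]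
  · simp [Matrix.mul_sub, Matrix.sub_mul, rowSpaceProj_mul_self h.orthonormal_right]

/-- The output `A S (R S)† R` solves the regression of `A` on the rows of `R` from the sampled
columns `S`. If `S` almost preserves the geometry of the right singular vectors of `R`, then it
loses little against the exact solution `A P`, where `P` projects onto the row space of `R`. -/
theorem IsSVD.frobNorm_sub_curApprox_le (h : IsSVD R U σ V) (A : Matrix (Fin m) (Fin n) ℝ)
    {g s : ℕ} (S : Matrix (Fin n) (Fin g × Fin s) ℝ)
    (hG : frobNorm ((Vᵀ * S) * (Vᵀ * S)ᵀ - 1) ≤ 1 / 2) {B : Matrix (Fin m) (Fin n) ℝ}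
    (hB : B = A - A * rowSpaceProj σ V) :
    frobNorm (A - curApprox A R S) ≤
      frobNorm B + 2 * Real.sqrt q * frobNorm ((B * S) * (Vᵀ * S)ᵀ - B * V) := by
  have hV := h.orthonormal_right
  set D := singularSupport σ with hD
  set T := Vᵀ * S with hT
  set W := R * S with hW
  set Y := pinv W with hY
  set N := Y * R with hN
  obtain ⟨hp1, hp2, -, hp4⟩ := pinv_penrose W
  have hWT : W = U * diagonal σ * T := by
    rw [hW, hT, ← Matrix.mul_assoc, ← h.eq]
  -- As `T` has full row rank, `W` and `R` have the same column space.
  have hWN : W * N = R := by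
    have hunit := (Matrix.isUnit_iff_isUnit_det _).1 (isUnit_of_frobNorm_sub_one_le hG)
    have hTT : T * (Tᵀ * (T * Tᵀ)⁻¹) = 1 := by
      rw [← Matrix.mul_assoc]
      exact mul_nonsing_inv _ hunit
    have hR : R = W * (Tᵀ * (T * Tᵀ)⁻¹ * Vᵀ) := by
      rw [hWT, ← Matrix.mul_assoc, Matrix.mul_assoc (U * diagonal σ), hTT, Matrix.mul_one, ← h.eq]
    calc W * N = W * Y * W * (Tᵀ * (T * Tᵀ)⁻¹ * Vᵀ) := by
          rw [hN, ← Matrix.mul_assoc]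
          conv_lhs => rhs; rw [hR]
          rw [← Matrix.mul_assoc]
      _ = R := by rw [hp1, ← hR]
  have hDTN : D * (T * N) = D * Vᵀ := by
    have hl : ∀ {c : ℕ} (M : Matrix (Fin q) (Fin c) ℝ),
        diagonal (fun t => (σ t)⁻¹) * Uᵀ * (U * diagonal σ * M) = D * M := by
      intro c M
      calc diagonal (fun t => (σ t)⁻¹) * Uᵀ * (U * diagonal σ * M)
          = diagonal (fun t => (σ t)⁻¹) * ((Uᵀ * U) * diagonal σ) * M := by
            simp only [Matrix.mul_assoc]
        _ = D * M := by
            rw [h.orthonormal_left, Matrix.one_mul, diagonal_inv_mul_diagonal]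
    rw [← hl, ← hl, ← Matrix.mul_assoc (U * diagonal σ), ← hWT, hWN, ← h.eq]
  set L := D * (diagonal σ * Uᵀ * Yᵀ * Y * R) with hL
  have hDL : D * L = L := by
    rw [hL, ← Matrix.mul_assoc, singularSupport_mul_self]
  have hNL : N = Tᵀ * L := by
    calc N = (Y * W) * Y * R := by rw [hp2]
      _ = (Y * W)ᵀ * Y * R := by rw [hp4]
      _ = Tᵀ * diagonal σ * Uᵀ * Yᵀ * Y * R := by
          rw [transpose_mul, hWT]
          simp only [transpose_mul, diagonal_transpose, Matrix.mul_assoc]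
      _ = Tᵀ * (D * diagonal σ) * Uᵀ * Yᵀ * Y * R := by rw [singularSupport_mul_diagonal]
      _ = Tᵀ * L := by rw [hL]; simp only [Matrix.mul_assoc]
  have hDle : ∀ {c : ℕ} (M : Matrix (Fin q) (Fin c) ℝ), frobNorm (D * M) ≤ frobNorm M := by
    intro c M
    rw [← frobNorm_transpose, transpose_mul, singularSupport_transpose, ← frobNorm_transpose M]
    exact frobNorm_mul_projection_le singularSupport_transpose singularSupport_mul_self _
  have hLn : frobNorm L ≤ 2 * Real.sqrt q := by
    have h1 : L = D * Vᵀ - D * (T * Tᵀ - 1) * L := by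
      rw [Matrix.mul_assoc, Matrix.sub_mul, Matrix.mul_assoc T, ← hNL, Matrix.mul_sub, hDTN,
        Matrix.one_mul, hDL]
      abel
    have h2 := frobNorm_le_two_mul ((hDle _).trans hG) h1
    have h3 := hDle Vᵀ
    rw [frobNorm_transpose, frobNorm_eq_sqrt_of_transpose_mul_self_eq_one hV] at h3
    linarith
  have hBVL : B * V * L = 0 := by
    have hPVD : rowSpaceProj σ V * (V * D) = V * D := by
      rw [← Matrix.mul_assoc, rowSpaceProj_mul hV, Matrix.mul_assoc, singularSupport_mul_self]
    have hBVD : B * (V * D) = 0 := by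
      rw [hB, Matrix.sub_mul, Matrix.mul_assoc A, hPVD, sub_self]
    rw [← hDL, ← Matrix.mul_assoc, Matrix.mul_assoc B, hBVD, Matrix.zero_mul]
  have hBSN : B * S * N = ((B * S) * Tᵀ - B * V) * L := by
    rw [Matrix.sub_mul, hBVL, sub_zero, hNL, Matrix.mul_assoc _ Tᵀ]
  have hPSN : A * rowSpaceProj σ V * S * N = A * rowSpaceProj σ V := by
    calc A * rowSpaceProj σ V * S * N = A * V * (D * (T * N)) := by
          simp only [rowSpaceProj, hT, ← hD, Matrix.mul_assoc]
      _ = A * rowSpaceProj σ V := by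
          rw [hDTN]
          simp only [rowSpaceProj, ← hD, Matrix.mul_assoc]
  have hfinal : A - curApprox A R S = B - ((B * S) * Tᵀ - B * V) * L := by
    rw [← hBSN, hB, Matrix.sub_mul, Matrix.sub_mul, hPSN, curApprox, ← hW, ← hY,
      Matrix.mul_assoc _ Y, ← hN]
    abel
  rw [hfinal]
  refine (frobNorm_sub_le _ _).trans (add_le_add_right ?_ _)
  refine (frobNorm_mul_le _ _).trans ?_
  rw [mul_comm]
  exact mul_le_mul_of_nonneg_right hLn (frobNorm_nonneg _)

end Regression

/-! ### The two sampling steps succeed -/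

open Classical in
/-- Two simultaneous applications of Markov's inequality. The constant `1280 = 20 · 64` leaves
each of the two events a failure probability of at most `1 / 20`. -/
theorem nine_tenths_le_iidExp_indicator {ι : Type*} [Fintype ι] {p : ι → ℝ} (hp : ∀ i, 0 ≤ p i)
    (hp1 : ∑ i, p i = 1) {N d : ℕ} (hd : 0 < d) {α β γ δ : Type*} [Fintype α] [Fintype β]
    [Fintype γ] [Fintype δ] (X : (Fin N → ι) → Matrix α β ℝ) (Z : (Fin N → ι) → Matrix γ δ ℝ)
    {ε b : ℝ} (hε0 : 0 < ε) (hε1 : ε < 1) (hb : 0 ≤ b)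
    (hX : iidExp p N (fun x => frobNorm (X x) ^ 2) ≤ ε ^ 2 / (1280 * d) * d)
    (hZ : iidExp p N (fun x => frobNorm (Z x) ^ 2) ≤ ε ^ 2 / (1280 * d) * b ^ 2) :
    9 / 10 ≤ iidExp p N fun x =>
      if frobNorm (X x) ≤ 1 / 2 ∧ 2 * Real.sqrt d * frobNorm (Z x) ≤ ε / 4 * b then 1 else 0 := by
  have hd' : (0 : ℝ) < d := by exact_mod_cast hd
  have h1 := one_sub_le_iidExp_indicator hp hp1 (fun x => sq_nonneg (frobNorm (X x)))
    (a := 1 / 4) (δ := 1 / 20) (by norm_num) (by norm_num) (hX.trans (by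
      have : ε ^ 2 / (1280 * d) * d = ε ^ 2 / 1280 := by field_simp
      rw [this]
      nlinarith))
  have h2 := one_sub_le_iidExp_indicator hp hp1 (fun x => sq_nonneg (frobNorm (Z x)))
    (a := ε ^ 2 / (64 * d) * b ^ 2) (δ := 1 / 20) (by norm_num) (by positivity)
    (hZ.trans (le_of_eq (by field_simp; ring)))
  have h3 := le_iidExp_indicator_and hp hp1 h1 h2
  refine le_trans (by norm_num) (h3.trans (iidExp_mono hp fun x => ?_))
  split_ifs with ha hb' hb'
  · exact le_rfl
  · refine absurd ⟨?_, ?_⟩ hb'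
    · nlinarith [ha.1, frobNorm_nonneg (X x)]
    · refine (sq_le_sq₀ (by have := frobNorm_nonneg (Z x); positivity) (by positivity)).1 ?_
      rw [mul_pow, mul_pow, Real.sq_sqrt hd'.le]
      calc (2 : ℝ) ^ 2 * d * frobNorm (Z x) ^ 2 ≤ 2 ^ 2 * d * (ε ^ 2 / (64 * d) * b ^ 2) :=
            mul_le_mul_of_nonneg_left ha.2 (by positivity)
        _ = (ε / 4 * b) ^ 2 := by field_simp; ring
  · exact zero_le_one
  · exact le_rfl

/-- The incoherence bounds the rows of a matrix with orthonormal columns; it is at least one. -/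
theorem incoherence_bounds {m k : ℕ} (hk : 1 ≤ k) {U : Matrix (Fin m) (Fin k) ℝ}
    (hU : Uᵀ * U = 1) : 0 < m ∧ 1 ≤ incoherence U ∧
      ∀ i, m * ∑ j, U i j ^ 2 ≤ k * incoherence U := by
  have hk' : (0 : ℝ) < k := by exact_mod_cast hk
  have hsum := frobNorm_sq_of_transpose_mul_self_eq_one hU
  rw [frobNorm_sq, Fintype.card_fin] at hsum
  have hm : 0 < m := by
    rcases Nat.eq_zero_or_pos m with rfl | h
    · simp at hsum
      exact absurd hsum hk'.ne
    · exact h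
  have hm' : (0 : ℝ) < m := by exact_mod_cast hm
  have hrow : ∀ i, m * ∑ j, U i j ^ 2 ≤ k * incoherence U := by
    intro i
    have h1 : ∑ j, U i j ^ 2 ≤ ⨆ i, ∑ j, U i j ^ 2 :=
      le_ciSup (f := fun i => ∑ j, U i j ^ 2) (Set.finite_range _).bddAbove i
    have h2 : k * incoherence U = m * ⨆ i, ∑ j, U i j ^ 2 := by
      rw [incoherence]; field_simp
    rw [h2]
    exact mul_le_mul_of_nonneg_left h1 hm'.le
  refine ⟨hm, ?_, hrow⟩
  have h3 := Finset.sum_le_sum fun i (_ : i ∈ Finset.univ) => hrow i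
  rw [← Finset.mul_sum, hsum] at h3
  simp only [Finset.sum_const, Finset.card_univ, Fintype.card_fin, nsmul_eq_mul] at h3
  have h4 : (m * k : ℝ) * 1 ≤ (m * k) * incoherence U := by linarith
  exact le_of_mul_le_mul_left h4 (by positivity)

open Classical in
/-- With probability at least `0.9`, the sampled rows span a good approximation of `A`. -/
theorem rowSampling_success {m n k r : ℕ} (hk : 1 ≤ k) {U : Matrix (Fin m) (Fin k) ℝ}
    (hU : Uᵀ * U = 1) (Y : Matrix (Fin k) (Fin n) ℝ) {B : Matrix (Fin m) (Fin n) ℝ}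
    (hB : Uᵀ * B = 0) {μ₀ ε : ℝ} (hμ : incoherence U ≤ μ₀) (hε0 : 0 < ε) (hε1 : ε < 1)
    (hr : 1280 * (μ₀ * (k : ℝ) ^ 2 / ε ^ 2) ≤ (r : ℝ)) :
    9 / 10 ≤ iidExp (fun _ : Fin m => 1 / (m : ℝ)) r fun I =>
      if ∃ X : Matrix (Fin m) (Fin r) ℝ,
        frobNorm (U * Y + B - X * rowSample (U * Y + B) I) ≤ (1 + ε / 4) * frobNorm B
        then 1 else 0 := by
  obtain ⟨hm, hμ1, hrow⟩ := incoherence_bounds hk hU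
  have hk' : (0 : ℝ) < k := by exact_mod_cast hk
  have hm' : (0 : ℝ) < m := by exact_mod_cast hm
  have hμ0 : 0 < μ₀ := by linarith
  have hr0 : (0 : ℝ) < r := lt_of_lt_of_le (by positivity) hr
  have hr0' : 0 < r := by exact_mod_cast hr0
  have hrow' : ∀ i, m * ∑ j, U i j ^ 2 ≤ k * μ₀ := fun i =>
    (hrow i).trans (mul_le_mul_of_nonneg_left hμ hk'.le)
  have hθ : k * μ₀ / r ≤ ε ^ 2 / (1280 * k) := by
    rw [div_le_div_iff₀ hr0 (by positivity)]
    have h1 : 1280 * (μ₀ * (k : ℝ) ^ 2 / ε ^ 2) * ε ^ 2 = k * μ₀ * (1280 * k) := by field_simp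
    rw [← h1, mul_comm]
    exact mul_le_mul_of_nonneg_left hr (by positivity)
  have hp : ∀ i : Fin m, 0 ≤ (fun _ : Fin m => 1 / (m : ℝ)) i := fun _ => by positivity
  have hp1 : ∑ i : Fin m, (fun _ : Fin m => 1 / (m : ℝ)) i = 1 := by simp [hm'.ne']
  have h1 := rowSampling_product_error hm hr0' U U hrow'
  have h2 := rowSampling_product_error hm hr0' U B hrow'
  rw [frobNorm_sq_of_transpose_mul_self_eq_one hU, Fintype.card_fin, hU] at h1
  simp only [hB, sub_zero] at h2
  have h3 := nine_tenths_le_iidExp_indicator hp hp1 hk _ _ hε0 hε1 (frobNorm_nonneg B)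
    (h1.trans (mul_le_mul_of_nonneg_right hθ hk'.le))
    (h2.trans (mul_le_mul_of_nonneg_right hθ (sq_nonneg _)))
  refine h3.trans (iidExp_mono hp fun I => ?_)
  split_ifs with ha hb hb
  · exact le_rfl
  · obtain ⟨X, hX⟩ := exists_row_regression (rowSamplingMatrix I) hU Y B ha.1
    exact absurd ⟨X, hX.trans (by linarith [ha.2])⟩ hb
  · exact zero_le_one
  · exact le_rfl

open Classical in
/-- With probability at least `0.9`, the sampled blocks solve the regression on `R` almost as well
as any `X R` does. -/
theorem blockSampling_success {m n r G s g : ℕ} (A : Matrix (Fin m) (Fin n) ℝ)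
    {R : Matrix (Fin r) (Fin n) ℝ} (F : TopRightSingular R) (blk : Fin n ↪ Fin G × Fin s)
    {ε : ℝ} (hε0 : 0 < ε) (hε1 : ε < 1)
    (hg : 1280 * ((r : ℝ) ^ 2 / (blockStableRank blk F.V * ε ^ 2)) ≤ (g : ℝ)) :
    9 / 10 ≤ iidExp (blockProb blk F.V) g fun J =>
      if ∀ X : Matrix (Fin m) (Fin r) ℝ,
        frobNorm (A - curApprox A R (blockSamplingMatrix blk (blockProb blk F.V) J)) ≤
        (1 + ε / 4) * frobNorm (A - X * R) then 1 else 0 := by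
  obtain ⟨U, σ, h⟩ := F.isSVD
  have hV := h.orthonormal_right
  have hq := F.q_pos
  have hq' : (0 : ℝ) < F.q := by exact_mod_cast hq
  have hqr : F.q ≤ r := by
    have h1 := rank_mul_le_right Uᵀ U
    rw [h.orthonormal_left, rank_one, Fintype.card_fin] at h1
    exact h1.trans (rank_le_height U)
  have hqr' : (F.q : ℝ) ≤ r := by exact_mod_cast hqr
  have hr' : (0 : ℝ) < r := hq'.trans_le hqr'
  have hα := blockStableRank_pos (blk := blk) hV hq
  have hg0 : (0 : ℝ) < g := lt_of_lt_of_le (by positivity) hg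
  have hg0' : 0 < g := by exact_mod_cast hg0
  set B := A - A * rowSpaceProj σ F.V with hB
  have hθ : F.q / (g * blockStableRank blk F.V) ≤ ε ^ 2 / (1280 * F.q) := by
    rw [div_le_div_iff₀ (by positivity) (by positivity)]
    calc F.q * (1280 * F.q : ℝ) = 1280 * (F.q : ℝ) ^ 2 := by ring
      _ ≤ 1280 * (r : ℝ) ^ 2 := by gcongr
      _ = ε ^ 2 * blockStableRank blk F.V *
          (1280 * ((r : ℝ) ^ 2 / (blockStableRank blk F.V * ε ^ 2))) := by field_simp
      _ ≤ ε ^ 2 * blockStableRank blk F.V * g := mul_le_mul_of_nonneg_left hg (by positivity)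
      _ = ε ^ 2 * (g * blockStableRank blk F.V) := by ring
  have h1 := blockSampling_product_error (blk := blk) hV hq hg0' F.Vᵀ
  have h2 := blockSampling_product_error (blk := blk) hV hq hg0' B
  rw [frobNorm_transpose, frobNorm_sq_of_transpose_mul_self_eq_one hV, Fintype.card_fin, hV] at h1
  have h3 := nine_tenths_le_iidExp_indicator blockProb_nonneg (sum_blockProb blk F.V hV hq) hq
    _ _ hε0 hε1 (frobNorm_nonneg B)
    (h1.trans (mul_le_mul_of_nonneg_right hθ hq'.le))
    (h2.trans (mul_le_mul_of_nonneg_right hθ (sq_nonneg _)))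
  refine h3.trans (iidExp_mono blockProb_nonneg fun J => ?_)
  split_ifs with ha hb hb
  · exact le_rfl
  · refine absurd (fun X => ?_) hb
    have h4 := h.frobNorm_sub_curApprox_le A _ ha.1 hB
    have h5 := h.frobNorm_sub_rowSpaceProj_le A X
    rw [← hB] at h5
    calc _ ≤ (1 + ε / 4) * frobNorm B := by linarith [ha.2]
      _ ≤ _ := mul_le_mul_of_nonneg_left h5 (by positivity)
  · exact zero_le_one
  · exact le_rfl

/-! ### The truncated singular value decomposition -/

theorem firstCols_transpose_mul {m q k : ℕ} (hk : k ≤ q) {U : Matrix (Fin m) (Fin q) ℝ}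
    (hU : Uᵀ * U = 1) :
    (firstCols hk U)ᵀ * U = (1 : Matrix (Fin q) (Fin q) ℝ).submatrix (Fin.castLE hk) id := by
  rw [← hU]
  rfl

theorem firstCols_orthonormal {m q k : ℕ} (hk : k ≤ q) {U : Matrix (Fin m) (Fin q) ℝ}
    (hU : Uᵀ * U = 1) : (firstCols hk U)ᵀ * firstCols hk U = 1 := by
  have h : (firstCols hk U)ᵀ * firstCols hk U =
      (Uᵀ * U).submatrix (Fin.castLE hk) (Fin.castLE hk) := rfl
  rw [h, hU, submatrix_one _ (Fin.castLE_injective hk)]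

theorem IsSVD.firstCols_transpose_mul_sub_svdTrunc {m n q k : ℕ} (hk : k ≤ q)
    {A : Matrix (Fin m) (Fin n) ℝ} {U : Matrix (Fin m) (Fin q) ℝ} {σ : Fin q → ℝ}
    {V : Matrix (Fin n) (Fin q) ℝ} (h : IsSVD A U σ V) :
    (firstCols hk U)ᵀ * (A - svdTrunc hk U σ V) = 0 := by
  have h1 : (firstCols hk U)ᵀ * A =
      diagonal (fun t => σ (Fin.castLE hk t)) * (firstCols hk V)ᵀ := by
    conv_lhs => rw [h.eq, ← Matrix.mul_assoc, ← Matrix.mul_assoc,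
      firstCols_transpose_mul hk h.orthonormal_left, Matrix.mul_assoc]
    ext i j
    simp [mul_apply, firstCols, diagonal_apply, one_apply]
  rw [Matrix.mul_sub, h1, svdTrunc, ← Matrix.mul_assoc, ← Matrix.mul_assoc,
    firstCols_orthonormal hk h.orthonormal_left, Matrix.one_mul, sub_self]

end BlockCUR

theorem lemma1 :
    ∃ c₁ c₂ : ℝ, 0 < c₁ ∧ 0 < c₂ ∧
      ∀ (m n ρ k r G s : ℕ) (A : Matrix (Fin m) (Fin n) ℝ)
        (U : Matrix (Fin m) (Fin ρ) ℝ) (σ : Fin ρ → ℝ) (V : Matrix (Fin n) (Fin ρ) ℝ)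
        (_hρ : ρ = A.rank) (_hA : BlockCUR.IsSVD A U σ V) (_hk1 : 1 ≤ k) (hk : k ≤ ρ)
        (μ₀ ε : ℝ) (_hμ : BlockCUR.incoherence (BlockCUR.firstCols hk U) ≤ μ₀)
        (_hε0 : 0 < ε) (_hε1 : ε < 1)
        (_hr : c₁ * (μ₀ * (k : ℝ) ^ 2 / ε ^ 2) ≤ (r : ℝ))
        (blk : Fin n ↪ Fin G × Fin s)
        (F : ∀ I : Fin r → Fin m, BlockCUR.TopRightSingular (BlockCUR.rowSample A I))
        (g : (Fin r → Fin m) → ℕ)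
        (_hg : ∀ I : Fin r → Fin m,
          c₂ * ((r : ℝ) ^ 2 / (BlockCUR.blockStableRank blk (F I).V * ε ^ 2)) ≤ (g I : ℝ)),
        7 / 10 ≤ BlockCUR.successProb A blk F g
          ((1 + ε) * BlockCUR.frobNorm (A - BlockCUR.svdTrunc hk U σ V)) := by
  classical
  refine ⟨1280, 1280, by norm_num, by norm_num, ?_⟩
  intro m n ρ k r G s A U σ V _ hA hk1 hk μ₀ ε hμ hε0 hε1 hr blk F g hg
  set B := A - BlockCUR.svdTrunc hk U σ V with hB
  set Y := Matrix.diagonal (fun t => σ (Fin.castLE hk t)) *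
    (BlockCUR.firstCols hk V).transpose with hY
  have hAB : BlockCUR.firstCols hk U * Y + B = A := by
    rw [hB, BlockCUR.svdTrunc, hY, Matrix.mul_assoc]
    abel
  have h1 := BlockCUR.rowSampling_success hk1
    (BlockCUR.firstCols_orthonormal hk hA.orthonormal_left) Y
    (hA.firstCols_transpose_mul_sub_svdTrunc hk) hμ hε0 hε1 hr
  rw [← hB, hAB] at h1
  have hb0 := BlockCUR.frobNorm_nonneg B
  have hp : ∀ i : Fin m, 0 ≤ (fun _ : Fin m => 1 / (m : ℝ)) i := fun _ => by positivity
  rw [BlockCUR.successProb]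
  -- Given good rows, the conditional success probability is at least `9 / 10`.
  refine le_trans ?_ (BlockCUR.iidExp_mono hp (f := fun I => 9 / 10 *
    if ∃ X : Matrix (Fin m) (Fin r) ℝ, BlockCUR.frobNorm (A - X * BlockCUR.rowSample A I) ≤
      (1 + ε / 4) * BlockCUR.frobNorm B then 1 else 0) fun I => ?_)
  · rw [BlockCUR.iidExp_const_mul]
    linarith
  · split_ifs with hX
    · obtain ⟨X, hX⟩ := hX
      rw [mul_one]
      refine (BlockCUR.blockSampling_success A (F I) blk hε0 hε1 (hg I)).trans
        (BlockCUR.iidExp_mono BlockCUR.blockProb_nonneg fun J => ?_)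
      split_ifs with ha hb hb
      · exact le_rfl
      · refine absurd ((ha X).trans ?_) hb
        calc (1 + ε / 4) * BlockCUR.frobNorm (A - X * BlockCUR.rowSample A I)
            ≤ (1 + ε / 4) * ((1 + ε / 4) * BlockCUR.frobNorm B) :=
              mul_le_mul_of_nonneg_left hX (by positivity)
          _ ≤ (1 + ε) * BlockCUR.frobNorm B := by
              rw [← mul_assoc]
              exact mul_le_mul_of_nonneg_right (by nlinarith) hb0
      · exact zero_le_one
      · exact le_rfl
    · rw [mul_zero]
      refine Finset.sum_nonneg fun J _ => mul_nonneg
        (Finset.prod_nonneg fun t _ => BlockCUR.blockProb_nonneg _) ?_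
      dsimp only
      split_ifs <;> norm_num
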